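/- A partition of a space $X$ is a family of pairwise disjoint nonempty subsets of $X$ with union $X$. A set $S$ of cardinals is *closed under singular limits* if for every singular cardinal $\kappa$: whenever $\{\nu\in S:\nu<\kappa\}$ is unbounded in $\kappa$ (i.e. for every $\mu<\kappa$ there is $\nu\in S$ with $\mu\le\nu<\kappa$), then $\kappa\in S$. Then the following two statements hold. 1. The set $\{\kappa : \text{there is a partition of the Cantor space } 2^\omega \text{ into exactly } \kappa \text{ closed sets}\}$ is closed under singular limits. 2. The closed partition spectrum $$\mathfrak{sp}(\mathrm{closed})=\{|\mathcal P| : \mathcal P \text{ is a partition of } \mathbb R \text{ into at least two closed sets}\}$$ is closed under singular limits. -/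

import Mathlib

universe u

/-- A set `S` of cardinals is closed under singular limits if it contains every singular cardinal
`κ` such that the members of `S` below `κ` are unbounded in `κ`. -/
def ClosedUnderSingularLimits (S : Set Cardinal.{u}) : Prop :=
  ∀ κ : Cardinal.{u}, κ.IsSingular → (∀ μ < κ, ∃ ν ∈ S, μ ≤ ν ∧ ν < κ) → κ ∈ S

/-- `P` is a partition of the space `X` into (nonempty) closed sets. -/
def IsClosedPartition {X : Type u} [TopologicalSpace X] (P : Set (Set X)) : Prop :=
  Setoid.IsPartition P ∧ ∀ K ∈ P, IsClosed K

/-- The set of all cardinals `κ` such that there is a partition of `X` into exactly `κ`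
closed sets. -/
def closedPartitionSizes (X : Type u) [TopologicalSpace X] : Set Cardinal.{u} :=
  {κ | ∃ P : Set (Set X), IsClosedPartition P ∧ Cardinal.mk P = κ}

/-- The closed partition spectrum: the set of all cardinalities of partitions of the real line
into at least two closed sets. -/
def closedPartitionSpectrum : Set Cardinal.{0} :=
  {κ | ∃ P : Set (Set ℝ), IsClosedPartition P ∧ 2 ≤ Cardinal.mk P ∧ Cardinal.mk P = κ}

/-! Suppose X is homeomorphic to its square and κ is singular. Fewer than κ sizes are cofinal in κ,
and some size ν < κ is at least their number. Cut the first coordinate into ν closed sets and, over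
the i-th of them, the second coordinate into ν_i closed sets, with the ν_i cofinal in κ: the number
of pieces is the sum of the ν_i, which is κ. This settles the Cantor space.

The line is not homeomorphic to its square, but it has the same uncountable sizes as the Cantor
space. From the line to the Cantor space, pull back along maps onto [-n, n] from clopen copies of
the Cantor space. Conversely, embed the Cantor space in ℝ, delete the open part meeting only
countably many pieces, and collapse the gaps of the remaining compact set X by the distribution
function g of an atomless measure with support X. The images of the pieces are nowhere dense and
overlap only among countably many of them; `exists_disjoint_closed_iUnion_eq` recuts these, and
preimages under g partition ℝ. -/

open Set Filter Topology Cardinal MeasureTheory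

/-! ### Disjoint closed sets and gap-collapsing maps on the line -/

/-- A countable union of closed sets of reals with empty interior is the union of a countable
disjoint family of closed sets. -/
theorem exists_disjoint_closed_iUnion_eq (F : ℕ → Set ℝ) (hF : ∀ n, IsClosed (F n))
    (hF' : ∀ n, interior (F n) = ∅) :
    ∃ E : ℕ × ℕ → Set ℝ, (∀ p, IsClosed (E p)) ∧ Pairwise (Function.onFun Disjoint E) ∧
      ⋃ p, E p = ⋃ n, F n := by
  have hdense : Dense (⋂ n, (F n)ᶜ) :=
    dense_iInter_of_isOpen (fun n => (hF n).isOpen_compl)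
      (fun n => interior_eq_empty_iff_dense_compl.1 (hF' n))
  obtain ⟨D, hDF, hDc, hD⟩ := hdense.exists_countable_dense_subset
  obtain ⟨e, rfl⟩ := hDc.exists_eq_range hD.nonempty
  have heF : ∀ k n, e k ∉ F n := fun k n h => mem_iInter.1 (hDF (mem_range_self k)) n h
  set H : ℕ → Set ℝ := fun n => ⋃ m ∈ Iio n, F m with hH
  have hHc : ∀ n, IsClosed (H n) := fun n =>
    (finite_Iio n).isClosed_biUnion fun m _ => hF m
  -- The endpoints avoid every `F n`, so `I k` and `C k` have the same trace on `F n`, which is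
  -- therefore relatively clopen.
  set I : ℕ → Set ℝ := fun k => Ioo (e k.unpair.1) (e k.unpair.2) with hI
  set C : ℕ → Set ℝ := fun k => Icc (e k.unpair.1) (e k.unpair.2) with hC
  have hCI : ∀ n k x, x ∈ F n → x ∈ C k → x ∈ I k := by
    intro n k x hx hxC
    refine ⟨lt_of_le_of_ne hxC.1 ?_, lt_of_le_of_ne hxC.2 ?_⟩
    · rintro rfl; exact heF _ _ hx
    · rintro rfl; exact heF _ _ hx
  -- The part of `F n` off the earlier sets is covered by the intervals missing `H n`; each point
  -- goes to the first of these.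
  set E : ℕ × ℕ → Set ℝ := fun p =>
    {x | Disjoint (C p.2) (H p.1) ∧ x ∈ F p.1 ∧ x ∈ C p.2 ∧
      ∀ j < p.2, Disjoint (C j) (H p.1) → x ∉ I j} with hE
  have hsub : ∀ p, E p ⊆ F p.1 := fun p x hx => hx.2.1
  refine ⟨E, ?_, ?_, ?_⟩
  · intro p
    refine isClosed_const.inter ((hF _).inter (isClosed_Icc.inter ?_))
    have : {x : ℝ | ∀ j < p.2, Disjoint (C j) (H p.1) → x ∉ I j} =
        ⋂ j, ⋂ (_ : j < p.2), ⋂ (_ : Disjoint (C j) (H p.1)), (I j)ᶜ := by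
      ext x; simp
    change IsClosed {x : ℝ | ∀ j < p.2, Disjoint (C j) (H p.1) → x ∉ I j}
    rw [this]
    exact isClosed_iInter fun j => isClosed_iInter fun _ => isClosed_iInter fun _ =>
      isOpen_Ioo.isClosed_compl
  · have key1 : ∀ n m k j, n < m → Disjoint (E (n, k)) (E (m, j)) := by
      intro n m k j h
      rw [Set.disjoint_left]
      intro x hx hx'
      exact Set.disjoint_left.1 hx'.1 hx'.2.2.1 (mem_biUnion h hx.2.1)
    have key2 : ∀ n k j, k < j → Disjoint (E (n, k)) (E (n, j)) := by
      intro n k j h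
      rw [Set.disjoint_left]
      intro x hx hx'
      exact hx'.2.2.2 k h hx.1 (hCI _ _ _ hx.2.1 hx.2.2.1)
    rintro ⟨n, k⟩ ⟨m, j⟩ hne
    rcases lt_trichotomy n m with h | rfl | h
    · exact key1 _ _ _ _ h
    · rcases lt_trichotomy k j with h | rfl | h
      · exact key2 _ _ _ h
      · exact absurd rfl hne
      · exact (key2 _ _ _ h).symm
    · exact (key1 _ _ _ _ h).symm
  · apply subset_antisymm
    · exact iUnion_subset fun p => (hsub p).trans (subset_iUnion F p.1)
    · intro x hx
      classical
      have hx' : ∃ n, x ∈ F n := mem_iUnion.1 hx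
      set n := Nat.find hx'
      have hxn : x ∈ F n := Nat.find_spec hx'
      have hxH : x ∈ (H n)ᶜ := by
        intro h
        obtain ⟨m, hm, hxm⟩ := mem_iUnion₂.1 h
        exact Nat.find_min hx' hm hxm
      obtain ⟨a, b, hab, hsubH⟩ :=
        mem_nhds_iff_exists_Ioo_subset.1 ((hHc n).isOpen_compl.mem_nhds hxH)
      obtain ⟨_, ⟨i, rfl⟩, hp1, hp2⟩ := hD.exists_between hab.1
      obtain ⟨_, ⟨j, rfl⟩, hq1, hq2⟩ := hD.exists_between hab.2
      have hk : ∃ k, Disjoint (C k) (H n) ∧ x ∈ I k := by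
        refine ⟨Nat.pair i j, ?_, ?_⟩
        · rw [Set.disjoint_left]
          intro y hy hyH
          simp only [hC, Nat.unpair_pair] at hy
          exact hsubH ⟨hp1.trans_le hy.1, hy.2.trans_lt hq2⟩ hyH
        · simp only [hI, Nat.unpair_pair]
          exact ⟨hp2, hq1⟩
      refine mem_iUnion.2 ⟨(n, Nat.find hk), (Nat.find_spec hk).1, hxn,
        Ioo_subset_Icc_self (Nat.find_spec hk).2, fun j hj hd hxj => Nat.find_min hk hj ⟨hd, hxj⟩⟩

/-- Every uncountable Borel set of reals carries a nonzero s-finite measure without point masses. -/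
theorem exists_noAtoms_measure_of_not_countable {s : Set ℝ} (hs : MeasurableSet s)
    (hs' : ¬ s.Countable) :
    ∃ μ : Measure ℝ, SFinite μ ∧ NullSingletonClass μ ∧ μ sᶜ = 0 ∧ μ s ≠ 0 := by
  have := hs.standardBorel
  have hR : ¬ Countable ℝ := fun h => Cardinal.not_countable_real (countable_univ_iff.2 h)
  -- Lebesgue measure is transported along a Borel isomorphism.
  let e : ℝ ≃ᵐ s := PolishSpace.measurableEquivOfNotCountable hR hs'
  have hm : Measurable (fun x => (e x : ℝ)) := measurable_subtype_coe.comp e.measurable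
  refine ⟨(volume : Measure ℝ).map (fun x => (e x : ℝ)), inferInstance, ⟨fun x => ?_⟩, ?_, ?_⟩
  · rw [Measure.map_apply hm (measurableSet_singleton x)]
    refine Set.Subsingleton.measure_zero ?_ _
    intro a ha b hb
    exact e.injective (Subtype.ext (ha.trans hb.symm))
  · rw [Measure.map_apply hm hs.compl]
    have : (fun x => (e x : ℝ)) ⁻¹' sᶜ = ∅ := by ext x; simp
    rw [this, measure_empty]
  · rw [Measure.map_apply hm hs]
    have : (fun x => (e x : ℝ)) ⁻¹' s = Set.univ := by ext x; simp
    rw [this]; simp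

/-- For a closed set of reals all of whose nonempty relatively open subsets are uncountable, there
is a continuous function which identifies two points exactly when no point of the set lies strictly
between them. -/
theorem exists_continuous_eq_iff_Ioo_inter_eq_empty {X : Set ℝ} (hX : IsClosed X)
    (hX' : ∀ U : Set ℝ, IsOpen U → (U ∩ X).Nonempty → ¬ (U ∩ X).Countable) :
    ∃ g : ℝ → ℝ, Continuous g ∧
      ∀ x y, x < y → (g x = g y ↔ Ioo x y ∩ X = ∅) := by
  have hch : ∀ p : ℚ × ℚ, ∃ μ : Measure ℝ, SFinite μ ∧ NullSingletonClass μ ∧ μ Xᶜ = 0 ∧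
      ((Ioo (p.1 : ℝ) p.2 ∩ X).Nonempty → μ (Ioo (p.1 : ℝ) p.2) ≠ 0) := by
    intro p
    by_cases h : (Ioo (p.1 : ℝ) p.2 ∩ X).Nonempty
    · obtain ⟨μ, h1, h2, h3, h4⟩ := exists_noAtoms_measure_of_not_countable
        (measurableSet_Ioo.inter hX.measurableSet) (hX' _ isOpen_Ioo h)
      exact ⟨μ, h1, h2, measure_mono_null (compl_subset_compl.2 inter_subset_right) h3,
        fun _ h0 => h4 (measure_mono_null inter_subset_left h0)⟩
    · exact ⟨0, inferInstance, ⟨fun _ => rfl⟩, rfl, fun h' => absurd h' h⟩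
  choose ρ h1 h2 h3 h4 using hch
  -- `toFinite` keeps the null sets and makes the distribution function finite.
  set μ : Measure ℝ := (Measure.sum ρ).toFinite with hμ
  have hnull : ∀ s, μ s = 0 ↔ ∀ p, ρ p s = 0 := by
    intro s
    rw [hμ, toFinite_apply_eq_zero_iff, Measure.sum_apply_eq_zero]
  have : NullSingletonClass μ := ⟨fun x => (hnull _).2 fun p => measure_singleton x⟩
  have hint : Integrable (fun _ : ℝ => (1 : ℝ)) μ := integrable_const 1
  have hsub : ∀ x y, x ≤ y → (∫ _ in (0 : ℝ)..y, (1 : ℝ) ∂μ) - ∫ _ in (0 : ℝ)..x, (1 : ℝ) ∂μ =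
      μ.real (Ioc x y) := by
    intro x y hxy
    rw [intervalIntegral.integral_interval_sub_left hint.intervalIntegrable
      hint.intervalIntegrable, intervalIntegral.integral_of_le hxy]
    simp
  refine ⟨fun b => ∫ _ in (0 : ℝ)..b, (1 : ℝ) ∂μ, hint.continuous_primitive 0, ?_⟩
  intro x y hxy
  have h5 : (∫ _ in (0 : ℝ)..x, (1 : ℝ) ∂μ) = (∫ _ in (0 : ℝ)..y, (1 : ℝ) ∂μ) ↔
      μ (Ioo x y) = 0 := by
    rw [eq_comm, ← sub_eq_zero, hsub x y hxy.le, measureReal_eq_zero_iff,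
      measure_congr Ioo_ae_eq_Ioc]
  refine h5.trans ⟨fun h => ?_, fun h => ?_⟩
  · rw [← not_nonempty_iff_eq_empty]
    rintro ⟨z, ⟨hxz, hzy⟩, hzX⟩
    obtain ⟨p, hp1, hp2⟩ := exists_rat_btwn hxz
    obtain ⟨q, hq1, hq2⟩ := exists_rat_btwn hzy
    exact h4 (p, q) ⟨z, ⟨hp2, hq1⟩, hzX⟩
      (measure_mono_null (Ioo_subset_Ioo hp1.le hq2.le) ((hnull _).1 h (p, q)))
  · refine (hnull _).2 fun p => measure_mono_null ?_ (h3 p)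
    exact fun z hz hzX => (Set.mem_empty_iff_false z).1 (h ▸ ⟨hz, hzX⟩)

/-! ### Partitions as colourings with closed fibres -/

/-- The nonempty members of a disjoint closed cover form a closed partition. -/
theorem IsClosedPartition.mk_image {X ι : Type*} [TopologicalSpace X] {A : ι → Set X}
    (hc : ∀ i, IsClosed (A i)) (hd : Pairwise (Function.onFun Disjoint A))
    (hu : ∀ x, ∃ i, x ∈ A i) : IsClosedPartition (A '' {i | (A i).Nonempty}) := by
  refine ⟨⟨?_, fun x => ?_⟩, ?_⟩
  · rintro ⟨i, hi, h⟩
    exact hi.ne_empty h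
  · obtain ⟨i, hi⟩ := hu x
    refine ⟨A i, ⟨mem_image_of_mem A ⟨x, hi⟩, hi⟩, ?_⟩
    rintro _ ⟨⟨j, -, rfl⟩, hj⟩
    by_contra hne
    exact Set.disjoint_left.1 (hd fun h => hne (congrArg A h)) hj hi
  · rintro _ ⟨i, -, rfl⟩
    exact hc i

theorem mk_nonempty_mem_closedPartitionSizes {X ι : Type u} [TopologicalSpace X] {A : ι → Set X}
    (hc : ∀ i, IsClosed (A i)) (hd : Pairwise (Function.onFun Disjoint A))
    (hu : ∀ x, ∃ i, x ∈ A i) : #{i | (A i).Nonempty} ∈ closedPartitionSizes X := by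
  refine ⟨_, .mk_image hc hd hu, Cardinal.mk_image_eq_of_injOn _ _ ?_⟩
  rintro i ⟨x, hx⟩ j - h
  by_contra hne
  exact Set.disjoint_left.1 (hd hne) hx (h ▸ hx)

theorem mk_range_mem_closedPartitionSizes {X ι : Type u} [TopologicalSpace X] {c : X → ι}
    (hc : ∀ i, IsClosed (c ⁻¹' {i})) : #(range c) ∈ closedPartitionSizes X := by
  have h := mk_nonempty_mem_closedPartitionSizes hc
    (fun i j hij => (disjoint_singleton.2 hij).preimage c) (fun x => ⟨c x, rfl⟩)
  have : {i | (c ⁻¹' {i}).Nonempty} = range c := by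
    ext i; simp [Set.Nonempty]
  rwa [this] at h

theorem exists_surjective_of_mem_closedPartitionSizes {X : Type u} [TopologicalSpace X]
    {κ : Cardinal.{u}} (h : κ ∈ closedPartitionSizes X) :
    ∃ (ι : Type u) (c : X → ι), (∀ i, IsClosed (c ⁻¹' {i})) ∧ Function.Surjective c ∧ #ι = κ := by
  obtain ⟨P, ⟨hP, hc⟩, rfl⟩ := h
  choose c hc1 hc2 using fun x => (hP.2 x).exists
  have hmem : ∀ (i : P) x, (⟨c x, hc1 x⟩ : P) = i ↔ x ∈ i.1 := by
    rintro ⟨i, hi⟩ x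
    refine ⟨fun h => ?_, fun h => Subtype.ext ((hP.2 x).unique ⟨hc1 x, hc2 x⟩ ⟨hi, h⟩)⟩
    have : c x = i := congrArg Subtype.val h
    exact this ▸ hc2 x
  refine ⟨P, fun x => ⟨c x, hc1 x⟩, fun i => ?_, fun i => ?_, rfl⟩
  · have : (fun x => (⟨c x, hc1 x⟩ : P)) ⁻¹' {i} = i.1 := by
      ext x; exact hmem i x
    rw [this]
    exact hc _ i.2
  · obtain ⟨x, hx⟩ := Setoid.nonempty_of_mem_partition hP i.2
    exact ⟨x, (hmem i x).2 hx⟩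

/-! ### Transfer between the Cantor space and the line -/

/-- Given a family of sets with closed union, there is a closed set `X` which contains all but
countably many of them, each nonempty relatively open subset of which meets uncountably many. -/
theorem exists_closed_forall_open_not_countable {Y ι : Type*} [TopologicalSpace Y]
    [SecondCountableTopology Y] (K : ι → Set Y) (hK : IsClosed (⋃ i, K i)) :
    ∃ X ⊆ ⋃ i, K i, IsClosed X ∧ {i | (K i \ X).Nonempty}.Countable ∧
      ∀ U, IsOpen U → (U ∩ X).Nonempty → ¬ {i | (K i ∩ X ∩ U).Nonempty}.Countable := by
  -- A Cantor–Bendixson removal that counts pieces instead of points.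
  set B := {b ∈ TopologicalSpace.countableBasis Y | {i | (K i ∩ b).Nonempty}.Countable} with hB
  have hBc : B.Countable := (TopologicalSpace.countable_countableBasis Y).mono (sep_subset _ _)
  have hU0 : IsOpen (⋃₀ B) := isOpen_sUnion fun b hb =>
    TopologicalSpace.isOpen_of_mem_countableBasis hb.1
  have hcount : {i | (K i ∩ ⋃₀ B).Nonempty}.Countable := by
    refine (hBc.biUnion fun b hb => hb.2).mono ?_
    rintro i ⟨x, hx, b, hb, hxb⟩
    exact mem_biUnion hb ⟨x, hx, hxb⟩
  refine ⟨(⋃ i, K i) \ ⋃₀ B, sdiff_subset, hK.sdiff hU0, hcount.mono ?_, ?_⟩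
  · rintro i ⟨x, hx, hxX⟩
    refine ⟨x, hx, ?_⟩
    by_contra hxB
    exact hxX ⟨mem_iUnion.2 ⟨i, hx⟩, hxB⟩
  · rintro U hU ⟨x, hxU, hxK, hxB⟩ hc
    obtain ⟨b, hb, hxb, hbU⟩ :=
      (TopologicalSpace.isBasis_countableBasis Y).exists_subset_of_mem_open hxU hU
    refine hxB ⟨b, ⟨hb, (hc.union hcount).mono ?_⟩, hxb⟩
    rintro i ⟨y, hyK, hyb⟩
    by_cases hy : y ∈ ⋃₀ B
    · exact Or.inr ⟨y, hyK, hy⟩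
    · exact Or.inl ⟨y, ⟨hyK, mem_iUnion.2 ⟨i, hyK⟩, hy⟩, hbU hyb⟩

/-- Indices of the members of a disjoint family meeting a countable set are countable. -/
theorem countable_setOf_inter_nonempty {Y ι : Type*} {K : ι → Set Y}
    (hd : Pairwise (Function.onFun Disjoint K)) {L : Set Y} (hL : L.Countable) :
    {i | (K i ∩ L).Nonempty}.Countable := by
  have h : ∀ i : {i | (K i ∩ L).Nonempty}, ∃ x, x ∈ K i ∩ L := fun i => i.2
  choose f hf using h
  have := hL.to_subtype
  have hinj : Function.Injective (fun i => (⟨f i, (hf i).2⟩ : L)) := by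
    intro i j hij
    have hij' : f i = f j := congrArg Subtype.val hij
    by_contra hne
    exact Set.disjoint_left.1 (hd fun h => hne (Subtype.ext h)) (hf i).1 (hij' ▸ (hf j).1)
  exact hinj.countable

/-- If uncountably many disjoint nonempty compact sets of reals have compact union, then the real
line can be partitioned into equally many closed sets. -/
theorem mk_mem_closedPartitionSizes_real_of_compact {ι : Type} (K : ι → Set ℝ)
    (hK : ∀ i, IsCompact (K i)) (hne : ∀ i, (K i).Nonempty)
    (hd : Pairwise (Function.onFun Disjoint K)) (hU : IsCompact (⋃ i, K i)) (hι : ℵ₀ < #ι) :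
    #ι ∈ closedPartitionSizes ℝ := by
  obtain ⟨X, hXK, hXc, hXi, hXU⟩ := exists_closed_forall_open_not_countable K hU.isClosed
  have hXi' : {i | (K i ∩ X).Nonempty}ᶜ.Countable := by
    refine hXi.mono fun i hi => ?_
    obtain ⟨x, hx⟩ := hne i
    exact ⟨x, hx, fun hxX => hi ⟨x, hx, hxX⟩⟩
  have hXu : ∀ U : Set ℝ, IsOpen U → (U ∩ X).Nonempty → ¬ (U ∩ X).Countable := by
    intro U hUo hUX hc
    refine hXU U hUo hUX ((countable_setOf_inter_nonempty hd hc).mono ?_)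
    rintro i ⟨x, ⟨h1, h2⟩, h3⟩
    exact ⟨x, h1, h3, h2⟩
  obtain ⟨g, hgc, hg⟩ := exists_continuous_eq_iff_Ioo_inter_eq_empty hXc hXu
  -- One-sided isolated points of `X`; they include all endpoints of gaps, the only points of `X`
  -- that `g` can identify.
  set L : Set ℝ := {x ∈ X | 𝓝[X ∩ Ioi x] x = ⊥} ∪ {x ∈ X | 𝓝[X ∩ Iio x] x = ⊥} with hL
  have hLc : L.Countable :=
    countable_setOfPred_isolated_right_within.union countable_setOfPred_isolated_left_within
  have hLlt : ∀ x ∈ X, ∀ y ∈ X, g x = g y → x < y → x ∈ L ∧ y ∈ L := by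
    intro x hx y hy hxy hlt
    have he := (hg x y hlt).1 hxy
    refine ⟨Or.inl ⟨hx, empty_mem_iff_bot.1 (mem_nhdsWithin.2 ⟨Iio y, isOpen_Iio, hlt, ?_⟩)⟩,
      Or.inr ⟨hy, empty_mem_iff_bot.1 (mem_nhdsWithin.2 ⟨Ioi x, isOpen_Ioi, hlt, ?_⟩)⟩⟩
    · rintro z ⟨h1, h2, h3⟩
      exact he ▸ ⟨⟨h3, h1⟩, h2⟩
    · rintro z ⟨h1, h2, h3⟩
      exact he ▸ ⟨⟨h1, h3⟩, h2⟩
  have hLne : ∀ x ∈ X, ∀ y ∈ X, g x = g y → x ≠ y → x ∈ L ∧ y ∈ L := by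
    intro x hx y hy hxy hne
    rcases hne.lt_or_gt with h | h
    · exact hLlt x hx y hy hxy h
    · exact (hLlt y hy x hx hxy.symm h).symm
  set F : ι → Set ℝ := fun i => g '' (K i ∩ X) with hF
  have hFc : ∀ i, IsClosed (F i) := fun i => (((hK i).inter_right hXc).image hgc).isClosed
  have hFe : ∀ i, interior (F i) = ∅ := by
    intro i
    rw [← not_nonempty_iff_eq_empty]
    rintro ⟨t, ht⟩
    obtain ⟨x, ⟨hxK, hxX⟩, rfl⟩ := interior_subset ht
    -- Points of `X` over the interior share their value with a point of `K i`, so they lie in `K i`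
    -- or in `L`: too few pieces.
    refine hXU (g ⁻¹' interior (F i)) (isOpen_interior.preimage hgc) ⟨x, ht, hxX⟩
      (((countable_singleton i).union (countable_setOf_inter_nonempty hd hLc)).mono ?_)
    rintro j ⟨y, ⟨hyK, hyX⟩, hy⟩
    obtain ⟨z, ⟨hzK, hzX⟩, hzy⟩ := interior_subset hy
    by_cases hyz : y = z
    · left
      by_contra hji
      exact Set.disjoint_left.1 (hd hji) hyK (hyz ▸ hzK)
    · exact Or.inr ⟨y, hyK, (hLne y hyX z hzX hzy.symm hyz).1⟩
  have hFd : ∀ i j, i ≠ j → ¬ (K i ∩ L).Nonempty → Disjoint (F i) (F j) := by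
    intro i j hij hi
    rw [Set.disjoint_left]
    rintro _ ⟨x, ⟨hxK, hxX⟩, rfl⟩ ⟨y, ⟨hyK, hyX⟩, hy⟩
    have hxy : x ≠ y := by
      rintro rfl
      exact Set.disjoint_left.1 (hd hij) hxK hyK
    exact hi ⟨x, hxK, (hLne x hxX y hyX hy.symm hxy).1⟩
  have hXne : X.Nonempty := by
    rw [nonempty_iff_ne_empty]
    rintro rfl
    simp only [inter_empty, Set.not_nonempty_empty, ofPred_false, compl_empty] at hXi'
    exact hι.not_ge (Cardinal.mk_le_aleph0_iff.2 (countable_univ_iff.1 hXi'))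
  have hXcomp : IsCompact X := hU.of_isClosed_subset hXc hXK
  have hgX : ∀ t, ∃ x ∈ X, g x = g t := by
    intro t
    -- The last point of `X` up to `t` serves or, failing that, the first point of `X`.
    by_cases ht : (X ∩ Iic t).Nonempty
    · obtain ⟨x, hx⟩ := (hXcomp.inter_right isClosed_Iic).exists_isGreatest ht
      refine ⟨x, hx.1.1, ?_⟩
      rcases (mem_Iic.1 hx.1.2).eq_or_lt with rfl | hlt
      · rfl
      · refine (hg x t hlt).2 (eq_empty_of_forall_notMem ?_)
        rintro z ⟨⟨h1, h2⟩, h3⟩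
        exact h1.not_ge (hx.2 ⟨h3, h2.le⟩)
    · obtain ⟨x, hx⟩ := hXcomp.exists_isLeast hXne
      have hlt : t < x := not_le.1 fun h => ht ⟨x, hx.1, h⟩
      refine ⟨x, hx.1, ((hg t x hlt).2 (eq_empty_of_forall_notMem ?_)).symm⟩
      rintro z ⟨⟨h1, h2⟩, h3⟩
      exact h2.not_ge (hx.2 h3)
  -- Pieces missing `X` are included so that every remaining image is nonempty and counts.
  set Bad : Set ι := {i | (K i ∩ L).Nonempty} ∪ {i | (K i ∩ X).Nonempty}ᶜ with hBad
  have hBadc : Bad.Countable := (countable_setOf_inter_nonempty hd hLc).union hXi'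
  obtain ⟨E, hEc, hEd, hEU⟩ : ∃ E : ℕ × ℕ → Set ℝ, (∀ p, IsClosed (E p)) ∧
      Pairwise (Function.onFun Disjoint E) ∧ ⋃ p, E p = ⋃ i ∈ Bad, F i := by
    rcases Bad.eq_empty_or_nonempty with h | h
    · exact ⟨fun _ => ∅, fun _ => isClosed_empty, fun _ _ _ => Set.disjoint_empty _, by simp [h]⟩
    · obtain ⟨f, hf⟩ := hBadc.exists_eq_range h
      obtain ⟨E, h1, h2, h3⟩ := exists_disjoint_closed_iUnion_eq (fun n => F (f n))
        (fun n => hFc _) (fun n => hFe _)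
      exact ⟨E, h1, h2, by rw [h3, hf, biUnion_range]⟩
  let A : (ℕ × ℕ) ⊕ {i // i ∉ Bad} → Set ℝ :=
    Sum.elim (fun p => g ⁻¹' E p) (fun i => g ⁻¹' F i)
  have hEF : ∀ p, ∀ i ∉ Bad, Disjoint (E p) (F i) := by
    intro p i hi
    rw [Set.disjoint_left]
    intro t ht hti
    have : t ∈ ⋃ i ∈ Bad, F i := hEU ▸ mem_iUnion.2 ⟨p, ht⟩
    obtain ⟨j, hj, htj⟩ := mem_iUnion₂.1 this
    refine Set.disjoint_left.1 (hFd i j ?_ fun h => hi (Or.inl h)) hti htj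
    rintro rfl
    exact hi hj
  have key := mk_nonempty_mem_closedPartitionSizes (A := A) ?_ ?_ ?_
  · convert key using 1
    have : Infinite ι := Cardinal.infinite_iff.2 hι.le
    have hcompl : #{i // i ∉ Bad} = #ι :=
      Cardinal.mk_compl_of_infinite Bad ((Cardinal.mk_le_aleph0_iff.2 hBadc).trans_lt hι)
    apply le_antisymm
    · rw [← hcompl]
      refine Cardinal.mk_le_of_injective (f := fun i => ⟨Sum.inr i, ?_⟩) ?_
      · have hi : (K i ∩ X).Nonempty := not_not.1 fun h => i.2 (Or.inr h)
        obtain ⟨x, hx⟩ := hi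
        exact ⟨x, mem_image_of_mem g hx⟩
      · intro i j h
        exact Sum.inr_injective (congrArg Subtype.val h)
    · refine (Cardinal.mk_set_le _).trans ?_
      rw [Cardinal.mk_sum, hcompl]
      simp [Cardinal.add_eq_right hι.le hι.le]
  · rintro (p | i)
    · exact (hEc p).preimage hgc
    · exact (hFc i).preimage hgc
  · rintro (p | i) (q | j) h
    · exact (hEd fun h' => h (congrArg _ h')).preimage g
    · exact (hEF p j j.2).preimage g
    · exact (hEF q i i.2).symm.preimage g
    · refine (hFd i j (fun h' => h (congrArg _ (Subtype.ext h'))) fun h' => i.2 (Or.inl h')).preimage g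
  · intro t
    obtain ⟨x, hxX, hx⟩ := hgX t
    obtain ⟨i, hi⟩ := mem_iUnion.1 (hXK hxX)
    have hti : g t ∈ F i := ⟨x, ⟨hi, hxX⟩, hx⟩
    by_cases hb : i ∈ Bad
    · have : g t ∈ ⋃ p, E p := hEU ▸ mem_biUnion hb hti
      obtain ⟨p, hp⟩ := mem_iUnion.1 this
      exact ⟨Sum.inl p, hp⟩
    · exact ⟨Sum.inr ⟨i, hb⟩, hti⟩

/-- Every uncountable closed partition size of the Cantor space is one of the real line. -/
theorem mem_closedPartitionSizes_real_of_nat_bool {κ : Cardinal.{0}} (hκ : ℵ₀ < κ)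
    (h : κ ∈ closedPartitionSizes (ℕ → Bool)) : κ ∈ closedPartitionSizes ℝ := by
  obtain ⟨ι, c, hc, hs, rfl⟩ := exists_surjective_of_mem_closedPartitionSizes h
  obtain ⟨e, -, hec, hei⟩ := isClosed_univ.exists_nat_bool_injection_of_not_countable
    (α := ℝ) Cardinal.not_countable_real
  refine mk_mem_closedPartitionSizes_real_of_compact (fun i => e '' (c ⁻¹' {i}))
    (fun i => (hc i).isCompact.image hec) (fun i => ?_) ?_ ?_ hκ
  · obtain ⟨x, rfl⟩ := hs i
    exact ⟨e x, mem_image_of_mem e rfl⟩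
  · intro i j hij
    exact (disjoint_image_iff hei).2 ((disjoint_singleton.2 hij).preimage c)
  · rw [← image_iUnion, ← preimage_iUnion, iUnion_of_singleton, preimage_univ]
    exact isCompact_univ.image hec

/-- Every uncountable closed partition size of the real line is one of the Cantor space. -/
theorem mem_closedPartitionSizes_nat_bool_of_real {κ : Cardinal.{0}} (hκ : ℵ₀ < κ)
    (h : κ ∈ closedPartitionSizes ℝ) : κ ∈ closedPartitionSizes (ℕ → Bool) := by
  obtain ⟨ι, c, hc, hs, rfl⟩ := exists_surjective_of_mem_closedPartitionSizes h
  have hex : ∀ n : ℕ, ∃ f : (ℕ → Bool) → ℝ, Continuous f ∧ Icc (-n : ℝ) n ⊆ range f := by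
    intro n
    have : Nonempty (Icc (-n : ℝ) n) := ⟨⟨0, by simp, by simp⟩⟩
    obtain ⟨f, hf, hfs⟩ := exists_nat_bool_continuous_surjective_of_compact (Icc (-n : ℝ) n)
    exact ⟨fun x => f x, continuous_subtype_val.comp hf, fun t ht =>
      (hfs ⟨t, ht⟩).imp fun x hx => congrArg Subtype.val hx⟩
  choose f hf hfs using hex
  have htail : ∀ n : ℕ, Continuous fun (x : ℕ → Bool) k => x (k + n + 1) := fun n => by fun_prop
  -- The first `true` is at `n`; dropping the first n + 1 coordinates identifies `C n` with the
  -- whole space.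
  let C : ℕ → Set (ℕ → Bool) := fun n => {x | x n = true} ∩ ⋂ m ∈ Iio n, {x | x m = false}
  have hCc : ∀ n, IsClosed (C n) := fun n =>
    (isClosed_eq (continuous_apply n) continuous_const).inter
      (isClosed_biInter fun m _ => isClosed_eq (continuous_apply m) continuous_const)
  have hCd : ∀ n m x, x ∈ C n → x ∈ C m → n = m := by
    intro n m x hn hm
    simp only [C, mem_inter_iff, mem_ofPred_eq, mem_iInter, mem_Iio] at hn hm
    rcases lt_trichotomy n m with h | h | h
    · simp [hm.2 n h] at hn
    · exact h
    · simp [hn.2 m h] at hm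
  let A : Option (ℕ × ι) → Set (ℕ → Bool) := fun o =>
    o.elim {fun _ => false} fun p => C p.1 ∩ {x | c (f p.1 fun k => x (k + p.1 + 1)) = p.2}
  have key := mk_nonempty_mem_closedPartitionSizes (A := A) ?_ ?_ ?_
  · convert key using 1
    have : Infinite ι := Cardinal.infinite_iff.2 hκ.le
    apply le_antisymm
    · have hi : ∀ i : ι, ∃ n, (A (some (n, i))).Nonempty := by
        intro i
        obtain ⟨t, rfl⟩ := hs i
        obtain ⟨n, hn⟩ := exists_nat_ge |t|
        obtain ⟨x, rfl⟩ := hfs n (abs_le.1 hn)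
        refine ⟨n, fun k => if k < n then false else if k = n then true else x (k - (n + 1)),
          ⟨by simp, ?_⟩, ?_⟩
        · simp only [mem_iInter, mem_Iio, mem_ofPred_eq]
          intro m hm
          simp [hm]
        · have : (fun k => if k + n + 1 < n then false else if k + n + 1 = n then true
              else x (k + n + 1 - (n + 1))) = x := by
            funext k
            rw [if_neg (by omega), if_neg (by omega)]
            congr 1
            omega
          simp only [mem_ofPred_eq, this]
      choose n hn using hi
      refine Cardinal.mk_le_of_injective (f := fun i => ⟨some (n i, i), hn i⟩) ?_
      intro i j h
      have := congrArg Subtype.val h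
      simp only [Option.some.injEq, Prod.mk.injEq] at this
      exact this.2
    · refine (Cardinal.mk_set_le _).trans ?_
      have h1 : (1 : Cardinal) ≤ #ι := Cardinal.one_le_aleph0.trans hκ.le
      simp [Cardinal.mk_option, Cardinal.aleph0_mul_eq hκ.le,
        Cardinal.add_one_eq hκ.le]
  · rintro (_ | ⟨n, i⟩)
    · exact isClosed_singleton
    · exact (hCc n).inter ((hc i).preimage ((hf n).comp (htail n)))
  · have hn : ∀ p x, x ∈ A (some p) → x ∉ A none := by
      rintro ⟨n, i⟩ x ⟨⟨hx, -⟩, -⟩ rfl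
      simp at hx
    rintro (_ | p) (_ | q) h <;> refine Set.disjoint_left.2 fun x hx hx' => ?_
    · exact h rfl
    · exact hn _ _ hx' hx
    · exact hn _ _ hx hx'
    · obtain ⟨n, i⟩ := p
      obtain ⟨m, j⟩ := q
      obtain rfl := hCd n m x hx.1 hx'.1
      exact h (congrArg (fun i => some (n, i)) (hx.2.symm.trans hx'.2))
  · intro x
    by_cases hx : ∃ n, x n = true
    · classical
      refine ⟨some (Nat.find hx, c (f (Nat.find hx) fun k => x (k + Nat.find hx + 1))),
        ⟨Nat.find_spec hx, ?_⟩, rfl⟩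
      simp only [mem_iInter, mem_Iio, mem_ofPred_eq]
      intro m hm
      simpa using Nat.find_min hx hm
    · refine ⟨none, ?_⟩
      funext n
      simpa using not_exists.1 hx n

/-! ### Singular limits -/

/-- A singular cardinal is the supremum of a family of fewer than `κ` smaller cardinals. -/
theorem exists_cofinal_family_of_isSingular {κ : Cardinal.{u}} (hκ : κ.IsSingular) :
    ∃ (β : Type u) (m : β → Cardinal.{u}), #β < κ ∧ (∀ b, m b < κ) ∧
      ∀ μ < κ, ∃ b, μ ≤ m b := by
  obtain ⟨s, hs, hcard⟩ := Order.exists_cof_eq κ.ord.ToType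
  refine ⟨s, fun x => #(Iio x.1), ?_, fun x => ?_, fun μ hμ => ?_⟩
  · rw [hcard, Ordinal.cof_toType]
    exact hκ.cof_ord_lt
  · simpa using Cardinal.mk_Iio_lt x.1
  · have hlt : μ.ord < Ordinal.type (α := κ.ord.ToType) (· < ·) := by
      simpa using Cardinal.ord_lt_ord.2 hμ
    obtain ⟨y, hy⟩ := Ordinal.typein_surj (α := κ.ord.ToType) (· < ·) hlt
    obtain ⟨x, hx, hyx⟩ := hs y
    refine ⟨⟨x, hx⟩, ?_⟩
    calc μ = #(Iio y) := by
          rw [← Cardinal.card_ord μ, ← hy]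
          exact Ordinal.card_typein y
      _ ≤ _ := Cardinal.mk_le_mk_of_subset (Iio_subset_Iio hyx)

/-- For a space homeomorphic to its square, the closed partition sizes are closed under singular
limits. -/
theorem closedUnderSingularLimits_closedPartitionSizes {X : Type u} [TopologicalSpace X]
    (h : (X × X) ≃ₜ X) : ClosedUnderSingularLimits (closedPartitionSizes X) := by
  intro κ hκ hS
  obtain ⟨β, m, hβ, hm, hmκ⟩ := exists_cofinal_family_of_isSingular hκ
  obtain ⟨ν, hν, hβν, hνκ⟩ := hS _ hβ
  obtain ⟨ι, c, hc, hcs, rfl⟩ := exists_surjective_of_mem_closedPartitionSizes hν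
  obtain ⟨j⟩ : Nonempty (β ↪ ι) := hβν
  have hν' : ∀ i : ι, ∃ ν ∈ closedPartitionSizes X, ν < κ ∧ ∀ b, j b = i → m b ≤ ν := by
    intro i
    by_cases hi : ∃ b, j b = i
    · obtain ⟨b, rfl⟩ := hi
      obtain ⟨ν, h1, h2, h3⟩ := hS _ (hm b)
      exact ⟨ν, h1, h3, fun b' hb' => j.injective hb' ▸ h2⟩
    -- Indices not coming from `β` only need some size below `κ`.
    · exact ⟨_, hν, hνκ, fun b hb => absurd ⟨b, hb⟩ hi⟩
  choose n hnS hnκ hn using hν'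
  choose J d hd hds hJ using fun i => exists_surjective_of_mem_closedPartitionSizes (hnS i)
  let C : X → Σ i, J i := fun x => ⟨c (h.symm x).1, d _ (h.symm x).2⟩
  have hCs : Function.Surjective C := by
    rintro ⟨i, k⟩
    obtain ⟨x, rfl⟩ := hcs i
    obtain ⟨y, rfl⟩ := hds _ k
    refine ⟨h (x, y), ?_⟩
    change (fun p : X × X => (⟨c p.1, d _ p.2⟩ : Σ i, J i)) (h.symm (h (x, y))) = _
    rw [h.symm_apply_apply]
  have hCc : ∀ p, IsClosed (C ⁻¹' {p}) := by
    rintro ⟨i, k⟩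
    have : C ⁻¹' {⟨i, k⟩} = h.symm ⁻¹' ((c ⁻¹' {i}) ×ˢ (d i ⁻¹' {k})) := by
      ext x
      simp only [C, mem_preimage, mem_singleton_iff, mem_prod]
      constructor
      · intro hx
        cases hx
        exact ⟨rfl, rfl⟩
      · rintro ⟨rfl, rfl⟩
        rfl
    rw [this]
    exact ((hc i).prod (hd i k)).preimage h.symm.continuous
  have key := mk_range_mem_closedPartitionSizes hCc
  rw [hCs.range_eq, Cardinal.mk_univ, Cardinal.mk_sigma] at key
  convert key using 1
  simp only [hJ]
  apply le_antisymm
  · refine le_of_forall_lt fun μ hμ => ?_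
    -- The successor of `μ` gives a strict inequality.
    obtain ⟨b, hb⟩ := hmκ _ (hκ.isSuccLimit.succ_lt hμ)
    exact (Order.succ_le_iff.1 hb).trans_le ((hn _ b rfl).trans (Cardinal.le_sum n _))
  · refine (Cardinal.sum_le_sum _ (fun _ => κ) fun i => (hnκ i).le).trans ?_
    rw [Cardinal.sum_const']
    exact (mul_le_mul_left hνκ.le κ).trans (Cardinal.mul_eq_self hκ.aleph0_le).le

theorem mem_closedPartitionSpectrum_iff {κ : Cardinal.{0}} :
    κ ∈ closedPartitionSpectrum ↔ κ ∈ closedPartitionSizes ℝ ∧ 2 ≤ κ := by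
  constructor
  · rintro ⟨P, h1, h2, rfl⟩
    exact ⟨⟨P, h1, rfl⟩, h2⟩
  · rintro ⟨⟨P, h1, rfl⟩, h2⟩
    exact ⟨P, h1, h2, rfl⟩

theorem corollary2p7 :
    ClosedUnderSingularLimits (closedPartitionSizes (ℕ → Bool)) ∧
      ClosedUnderSingularLimits closedPartitionSpectrum := by
  have hprod : ((ℕ → Bool) × (ℕ → Bool)) ≃ₜ (ℕ → Bool) :=
    (Homeomorph.sumArrowHomeomorphProdArrow (X := Bool)).symm.trans
      (Homeomorph.piCongrLeft (Y := fun _ => Bool) Equiv.natSumNatEquivNat)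
  have hC := closedUnderSingularLimits_closedPartitionSizes hprod
  refine ⟨hC, fun κ hκ hS => ?_⟩
  have hω : ℵ₀ < κ := lt_of_le_of_ne hκ.aleph0_le fun h => not_isSingular_aleph0 (h ▸ hκ)
  have hsucc : Order.succ ℵ₀ < κ := hκ.isSuccLimit.succ_lt hω
  refine mem_closedPartitionSpectrum_iff.2
    ⟨mem_closedPartitionSizes_real_of_nat_bool hω (hC κ hκ fun μ hμ => ?_),
      (Cardinal.natCast_lt_aleph0 (n := 2)).le.trans hω.le⟩
  -- Sizes of at least ℵ₁ are requested because the transfer covers only uncountable ones.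
  obtain ⟨ν, hν, hle, hlt⟩ := hS (max μ (Order.succ ℵ₀)) (max_lt hμ hsucc)
  exact ⟨ν, mem_closedPartitionSizes_nat_bool_of_real
    (Order.succ_le_iff.1 ((le_max_right _ _).trans hle))
    (mem_closedPartitionSpectrum_iff.1 hν).1, (le_max_left _ _).trans hle, hlt⟩
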